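/- Consider the Volterra chain on the half-line, \[ u_n'(t)=u_n(t)\bigl(u_{n+1}(t)-u_{n-1}(t)\bigr),\quad n\ge 1,\qquad u_0(t)\equiv 0, \] with the initial data $u_n(0)=1$ for all $n\ge1$. This Cauchy problem has exactly one solution $(u_n)_{n\ge0}$ consisting of real-valued differentiable functions on all of $\mathbb{R}$, and this solution has the following asymptotics. As $t\to+\infty$, \[ u_{2j-1}(t)=4-\frac{4j-1}{2t}+O(t^{-2})\quad (j\ge 1),\qquad u_{2j}(t)=\frac{j(2j+1)}{8t^2}+O(t^{-3})\quad (j\ge 0), \] and, as $t\to-\infty$, \[ u_n(t)=-\frac{n}{2t}+O(t^{-2})\quad (n\ge 0). \] The constants in the $O$-terms may depend on the index ($j$, respectively $n$). -/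

import Mathlib

open Filter Asymptotics

/-- `u : ℕ → ℝ → ℝ` is a solution, on the whole real time axis, of the Cauchy problem for the
Volterra chain `u_n' = u_n (u_{n+1} - u_{n-1})` on the half-line `n > 0`, with `u_0 = 0` and
`u_n(0) = 1` for all `n ≥ 1`. -/
structure IsVolterraStepSolution (u : ℕ → ℝ → ℝ) : Prop where
  boundary : ∀ t : ℝ, u 0 t = 0
  initial : ∀ n : ℕ, 1 ≤ n → u n 0 = 1
  chain : ∀ n : ℕ, 1 ≤ n → ∀ t : ℝ,
    HasDerivAt (u n) (u n t * (u (n + 1) t - u (n - 1) t)) t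

/-! The chain is a Lax flow for the Jacobi matrix `J` with zero diagonal, ones above it and the `u
n` below it. Its spectral measure evolves, up to normalisation, by the factor `exp (t x²)`, starting
from the semicircle law on `[-2, 2]`, which belongs to `u n = 1`.

Uniqueness: a solution stays positive for `n ≥ 1`. With `tau u = exp ∫ u 1`, the `k`-th derivative
of `tau u` is `tau u` times the corner entry of `J ^ (2k)`, a polynomial with nonnegative
coefficients in the `u n`. So `tau u` is absolutely monotone on the whole line, hence determined by
its jet at `0`, that is by the initial data. It determines `u 1`, and the chain then gives the other
`u n` in turn. No growth condition in `n` is needed.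

Existence: the recurrence coefficients of the monic orthogonal polynomials for `exp (t x²)` times
the semicircle weight solve the chain (`volterra_of_moment_flow`); at `t = 0` the polynomials are of
Chebyshev type with all coefficients `1`.

Asymptotics: as `t → +∞` the mass concentrates at `x = ±2`, as `t → -∞` at `x = 0`. In the variable
`y = 4t - t x²`, respectively `y = -t x²`, the weight tends to `y ^ α exp (-y)` with `α = 1/2`,
respectively `α = -1/2`. The even-degree polynomials are orthogonal in `y`, and their recurrence
coefficients approach those of Laguerre, `2n + 1 + α` and `n (n + α)`, with error `O(1/t)`
(`approxConst_laguerre_recurrence`). These coefficients are `d - t (u (2n) + u (2n+1))` and `t² u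
(2n) u (2n-1)`, with `d = 4t` or `0`, from which each `u n` is recovered inductively. -/

/-- If `f' = f * g` with `g` continuous and `f 0 = 1`, then `f` is positive. -/
theorem pos_of_hasDerivAt_mul {f g : ℝ → ℝ} (hg : Continuous g) (h0 : f 0 = 1)
    (hf : ∀ t, HasDerivAt f (f t * g t) t) (t : ℝ) : 0 < f t := by
  have hG : ∀ t, HasDerivAt (fun x => ∫ s in (0 : ℝ)..x, g s) (g t) t := fun t =>
    (hg.integral_hasStrictDerivAt 0 t).hasDerivAt
  have hc : ∀ t, HasDerivAt (fun x => f x * Real.exp (-∫ s in (0 : ℝ)..x, g s)) 0 t := by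
    intro t
    refine ((hf t).mul (hG t).neg.exp).congr_deriv ?_
    ring
  have h := is_const_of_deriv_eq_zero (fun t => (hc t).differentiableAt)
    (fun t => (hc t).deriv) t 0
  simp only [intervalIntegral.integral_same, neg_zero, Real.exp_zero, mul_one, h0] at h
  by_contra hn
  have := mul_nonpos_of_nonpos_of_nonneg (not_lt.mp hn)
    (Real.exp_nonneg (-∫ s in (0 : ℝ)..t, g s))
  linarith

/-! ### Towers of derivatives with nonnegative entries -/

/-- All terms of the Taylor expansion at `s` are nonnegative to the right of `s`, so a single term
is a lower bound. This turns the value at one far point into bounds on all derivatives. -/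
theorem tower_lower_bound {F : ℕ → ℝ → ℝ} (hF : ∀ k t, HasDerivAt (F k) (F (k + 1) t) t)
    (hpos : ∀ k t, 0 ≤ F k t) (n k : ℕ) {s T : ℝ} (hsT : s ≤ T) :
    F (k + n) s * ((T - s) ^ n / n.factorial) ≤ F k T := by
  induction n generalizing k T with
  | zero =>
    have hm : Monotone (F k) := monotone_of_deriv_nonneg (fun t => (hF k t).differentiableAt)
      (fun t => by rw [(hF k t).deriv]; exact hpos _ _)
    simpa using hm hsT
  | succ n ih =>
    have hd : ∀ x, HasDerivAt
        (fun x => F k x - F (k + (n + 1)) s * ((x - s) ^ (n + 1) / (n + 1).factorial))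
        (F (k + 1) x - F (k + 1 + n) s * ((x - s) ^ n / n.factorial)) x := by
      intro x
      have h1 := ((((hasDerivAt_id x).sub_const s).pow (n + 1)).div_const
        ((n + 1).factorial : ℝ)).const_mul (F (k + (n + 1)) s)
      refine ((hF k x).sub h1).congr_deriv ?_
      have hfac : ((n.factorial : ℝ)) ≠ 0 := by positivity
      have : k + (n + 1) = k + 1 + n := by ring
      rw [this, Nat.factorial_succ]
      push_cast
      simp only [id]
      field_simp
    have hm : MonotoneOn
        (fun x => F k x - F (k + (n + 1)) s * ((x - s) ^ (n + 1) / (n + 1).factorial))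
        (Set.Ici s) := by
      refine monotoneOn_of_deriv_nonneg (convex_Ici s)
        (fun x _ => (hd x).continuousAt.continuousWithinAt)
        (fun x _ => (hd x).differentiableAt.differentiableWithinAt) ?_
      intro x hx
      rw [interior_Ici] at hx
      rw [(hd x).deriv]
      linarith [ih (k + 1) (le_of_lt hx)]
    have h := hm (Set.mem_Ici.mpr le_rfl) (Set.mem_Ici.mpr hsT) hsT
    simp only [sub_self, ne_eq, Nat.add_eq_zero_iff, one_ne_zero, and_false, not_false_eq_true,
      zero_pow, zero_div, mul_zero, sub_zero] at h
    linarith [hpos k s]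

theorem tower_abs_le_of_nonneg {D : ℕ → ℝ → ℝ} (hD : ∀ k t, HasDerivAt (D k) (D (k + 1) t) t)
    (h0 : ∀ k, D k 0 = 0) {C R : ℝ} (n k : ℕ) (hC : ∀ s ∈ Set.Icc 0 R, |D (k + n) s| ≤ C) :
    ∀ s ∈ Set.Icc 0 R, |D k s| ≤ C * (s ^ n / n.factorial) := by
  induction n generalizing k with
  | zero => simpa using hC
  | succ n ih =>
    have ih' := ih (k + 1) (by
      have : k + 1 + n = k + (n + 1) := by ring
      rwa [this])
    have hB : ∀ x, HasDerivAt (fun x : ℝ => C * (x ^ (n + 1) / (n + 1).factorial))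
        (C * (x ^ n / n.factorial)) x := by
      intro x
      refine (((hasDerivAt_pow (n + 1) x).div_const _).const_mul C).congr_deriv ?_
      have hfac : ((n.factorial : ℝ)) ≠ 0 := by positivity
      rw [Nat.factorial_succ]
      push_cast
      field_simp
    intro s hs
    exact image_norm_le_of_norm_deriv_right_le_deriv_boundary
      (f := D k) (f' := D (k + 1)) (a := 0) (b := R)
      (fun x _ => (hD k x).continuousAt.continuousWithinAt)
      (fun x _ => (hD k x).hasDerivWithinAt)
      (by simp [h0 k]) hB
      (fun x hx => ih' x ⟨hx.1, hx.2.le⟩) hs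

theorem tower_abs_le {D : ℕ → ℝ → ℝ} (hD : ∀ k t, HasDerivAt (D k) (D (k + 1) t) t)
    (h0 : ∀ k, D k 0 = 0) {C R : ℝ} (n : ℕ) (hC : ∀ s, |s| ≤ R → |D n s| ≤ C)
    {s : ℝ} (hs : |s| ≤ R) : |D 0 s| ≤ C * (|s| ^ n / n.factorial) := by
  rcases le_total 0 s with h | h
  · rw [abs_of_nonneg h] at hs ⊢
    refine tower_abs_le_of_nonneg hD h0 n 0 (fun x hx => ?_) s ⟨h, hs⟩
    rw [zero_add]
    exact hC x (by rw [abs_of_nonneg hx.1]; exact hx.2)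
  · rw [abs_of_nonpos h] at hs ⊢
    -- Reflecting `x ↦ -x` gives another tower with vanishing jet.
    have := tower_abs_le_of_nonneg (D := fun k x => (-1) ^ k * D k (-x)) (C := C) (R := R)
      (fun k t => by
        refine (((hD k (-t)).comp t (hasDerivAt_neg t)).const_mul ((-1 : ℝ) ^ k)).congr_deriv ?_
        ring)
      (fun k => by simp [h0 k]) n 0 (fun x hx => by
        simp only [zero_add, abs_mul, abs_pow, abs_neg, abs_one, one_pow, one_mul]
        exact hC _ (by rw [abs_neg, abs_of_nonneg hx.1]; exact hx.2)) (-s) ⟨by linarith, hs⟩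
    simpa using this

/-- An absolutely monotone function on the real line is determined by its jet at the origin. -/
theorem absolutelyMonotone_tower_unique {F G : ℕ → ℝ → ℝ}
    (hF : ∀ k t, HasDerivAt (F k) (F (k + 1) t) t)
    (hG : ∀ k t, HasDerivAt (G k) (G (k + 1) t) t)
    (hFpos : ∀ k t, 0 ≤ F k t) (hGpos : ∀ k t, 0 ≤ G k t)
    (h0 : ∀ k, F k 0 = G k 0) (t : ℝ) : F 0 t = G 0 t := by
  set R : ℝ := |t| + 1 with hR
  have hRpos : 0 < R := by positivity
  -- Every `s` with `|s| ≤ R` lies at distance at least `2R` from `3R`. The resulting `n! / (2R)^n`,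
  -- against the Taylor remainder factor `R^n / n!`, leaves the decay `(1/2)^n`.
  have key : ∀ {F : ℕ → ℝ → ℝ}, (∀ k t, HasDerivAt (F k) (F (k + 1) t) t) →
      (∀ k t, 0 ≤ F k t) → ∀ (n : ℕ) (s : ℝ), |s| ≤ R →
      F n s ≤ F 0 (3 * R) * (n.factorial / (2 * R) ^ n) := by
    intro F hF hpos n s hs
    have hs' := (abs_le.mp hs).2
    have h1 := tower_lower_bound hF hpos n 0 (s := s) (T := 3 * R) (by linarith)
    have h2 : F (0 + n) s * ((2 * R) ^ n / n.factorial) ≤ F 0 (3 * R) := by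
      refine le_trans (mul_le_mul_of_nonneg_left ?_ (hpos _ _)) h1
      gcongr
      linarith
    rw [zero_add] at h2
    have : F n s = F n s * ((2 * R) ^ n / n.factorial) * (n.factorial / (2 * R) ^ n) := by
      field_simp
    rw [this]
    gcongr
  have hb : ∀ n : ℕ, |F 0 t - G 0 t| ≤ (F 0 (3 * R) + G 0 (3 * R)) * (1 / 2) ^ n := by
    intro n
    have h := tower_abs_le (D := fun k x => F k x - G k x)
      (fun k x => (hF k x).sub (hG k x)) (fun k => sub_eq_zero.mpr (h0 k))
      (C := (F 0 (3 * R) + G 0 (3 * R)) * (n.factorial / (2 * R) ^ n)) (R := R) n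
      (fun s hs => by
        have h1 := key hF hFpos n s hs
        have h2 := key hG hGpos n s hs
        have h3 := hFpos n s
        have h4 := hGpos n s
        rw [add_mul, abs_le]
        constructor <;> linarith) (s := t) (by linarith)
    refine h.trans ?_
    have h5 : |t| ^ n ≤ R ^ n := by gcongr; linarith
    have hsum : 0 ≤ F 0 (3 * R) + G 0 (3 * R) := add_nonneg (hFpos _ _) (hGpos _ _)
    calc (F 0 (3 * R) + G 0 (3 * R)) * (n.factorial / (2 * R) ^ n) * (|t| ^ n / n.factorial)
        ≤ (F 0 (3 * R) + G 0 (3 * R)) * (n.factorial / (2 * R) ^ n) * (R ^ n / n.factorial) := by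
          gcongr
      _ = (F 0 (3 * R) + G 0 (3 * R)) * (1 / 2) ^ n := by
          rw [mul_pow, one_div, inv_pow]
          field_simp
  have hlim : Tendsto (fun n : ℕ => (F 0 (3 * R) + G 0 (3 * R)) * (1 / 2 : ℝ) ^ n) atTop
      (nhds 0) := by
    simpa using (tendsto_pow_atTop_nhds_zero_of_lt_one (r := (1 / 2 : ℝ)) (by norm_num)
      (by norm_num)).const_mul (F 0 (3 * R) + G 0 (3 * R))
  have := ge_of_tendsto' hlim hb
  exact sub_eq_zero.mp (abs_nonpos_iff.mp this)

/-! ### Uniqueness for the Volterra chain -/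

/-- Weighted count of paths of length `k` from height `0` to height `n`, where a step down
from height `i` has weight `v i`. -/
def pathWeight (v : ℕ → ℝ) : ℕ → ℕ → ℝ
  | 0, 0 => 1
  | 0, _ + 1 => 0
  | k + 1, 0 => v 1 * pathWeight v k 1
  | k + 1, n + 1 => pathWeight v k n + v (n + 2) * pathWeight v k (n + 2)

theorem pathWeight_nonneg {v : ℕ → ℝ} (hv : ∀ n, 0 ≤ v n) (k n : ℕ) : 0 ≤ pathWeight v k n := by
  induction k generalizing n with
  | zero => cases n <;> simp [pathWeight]
  | succ k ih =>
    cases n with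
    | zero => exact mul_nonneg (hv _) (ih _)
    | succ n => exact add_nonneg (ih _) (mul_nonneg (hv _) (ih _))

theorem pathWeight_congr {v w : ℕ → ℝ} (h : ∀ n, 1 ≤ n → v n = w n) (k n : ℕ) :
    pathWeight v k n = pathWeight w k n := by
  induction k generalizing n with
  | zero => cases n <;> rfl
  | succ k ih =>
    cases n with
    | zero => simp only [pathWeight, ih, h 1 le_rfl]
    | succ n => simp only [pathWeight, ih, h (n + 2) (by omega)]

namespace IsVolterraStepSolution

variable {u : ℕ → ℝ → ℝ}

theorem continuous (hu : IsVolterraStepSolution u) (n : ℕ) : Continuous (u n) := by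
  rcases Nat.eq_zero_or_pos n with rfl | hn
  · rw [show u 0 = fun _ => 0 from funext hu.boundary]
    exact continuous_const
  · exact continuous_iff_continuousAt.mpr fun t => (hu.chain n hn t).continuousAt

theorem pos (hu : IsVolterraStepSolution u) {n : ℕ} (hn : 1 ≤ n) (t : ℝ) : 0 < u n t :=
  pos_of_hasDerivAt_mul (f := u n) ((hu.continuous (n + 1)).sub (hu.continuous (n - 1)))
    (hu.initial n hn) (hu.chain n hn) t

theorem nonneg (hu : IsVolterraStepSolution u) (n : ℕ) (t : ℝ) : 0 ≤ u n t := by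
  rcases Nat.eq_zero_or_pos n with rfl | hn
  · exact (hu.boundary t).ge
  · exact (hu.pos hn t).le

/-- Lax equation: path weights are the entries of row `0` of `J ^ k`. Removing from the last two
steps of a path those going up twice or returning to their height leaves `u (n+1) u (n+2) pathWeight
k (n+2)`, the double descents. At `n = 0` only the term `u 1` is subtracted, and the factor `tau`
absorbs it. -/
theorem hasDerivAt_pathWeight (hu : IsVolterraStepSolution u) (k n : ℕ) (t : ℝ) :
    HasDerivAt (fun t => pathWeight (u · t) k n)
      (pathWeight (u · t) (k + 2) n - (if 2 ≤ n then pathWeight (u · t) k (n - 2) else 0)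
        - (u n t + u (n + 1) t) * pathWeight (u · t) k n) t := by
  induction k generalizing n with
  | zero =>
    match n with
    | 0 =>
      refine (hasDerivAt_const t (1 : ℝ)).congr_deriv ?_
      simp [pathWeight, hu.boundary t]
    | 1 =>
      refine (hasDerivAt_const t (0 : ℝ)).congr_deriv ?_
      simp [pathWeight]
    | 2 =>
      refine (hasDerivAt_const t (0 : ℝ)).congr_deriv ?_
      simp [pathWeight]
    | n + 3 =>
      refine (hasDerivAt_const t (0 : ℝ)).congr_deriv ?_
      simp [pathWeight]
  | succ k ih =>
    match n with
    | 0 =>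
      refine ((hu.chain 1 le_rfl t).mul (ih 1)).congr_deriv ?_
      simp [pathWeight, hu.boundary t]
      ring
    | 1 =>
      refine ((ih 0).add ((hu.chain 2 (by omega) t).mul (ih 2))).congr_deriv ?_
      simp [pathWeight, hu.boundary t]
      ring
    | 2 =>
      refine ((ih 1).add ((hu.chain 3 (by omega) t).mul (ih 3))).congr_deriv ?_
      simp [pathWeight]
      ring
    | n + 3 =>
      refine ((ih (n + 2)).add ((hu.chain (n + 4) (by omega) t).mul (ih (n + 4)))).congr_deriv ?_
      simp [pathWeight]
      ring

/-- The tau function of a solution. -/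
noncomputable def tau (u : ℕ → ℝ → ℝ) (t : ℝ) : ℝ := Real.exp (∫ s in (0 : ℝ)..t, u 1 s)

theorem hasDerivAt_tau (hu : IsVolterraStepSolution u) (t : ℝ) :
    HasDerivAt (tau u) (tau u t * u 1 t) t :=
  ((hu.continuous 1).integral_hasStrictDerivAt 0 t).hasDerivAt.exp

theorem hasDerivAt_tau_mul_pathWeight (hu : IsVolterraStepSolution u) (k : ℕ) (t : ℝ) :
    HasDerivAt (fun t => tau u t * pathWeight (u · t) (2 * k) 0)
      (tau u t * pathWeight (u · t) (2 * (k + 1)) 0) t := by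
  refine ((hu.hasDerivAt_tau t).mul (hu.hasDerivAt_pathWeight (2 * k) 0 t)).congr_deriv ?_
  simp [hu.boundary t, mul_add]
  ring

theorem tau_unique {v : ℕ → ℝ → ℝ} (hu : IsVolterraStepSolution u)
    (hv : IsVolterraStepSolution v) : tau u = tau v := by
  funext t
  have h := absolutelyMonotone_tower_unique hu.hasDerivAt_tau_mul_pathWeight
    hv.hasDerivAt_tau_mul_pathWeight
    (fun k t => mul_nonneg (Real.exp_nonneg _) (pathWeight_nonneg (fun n => hu.nonneg n t) _ _))
    (fun k t => mul_nonneg (Real.exp_nonneg _) (pathWeight_nonneg (fun n => hv.nonneg n t) _ _))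
    (fun k => by
      rw [pathWeight_congr (v := (u · 0)) (w := (v · 0))
        (fun n hn => by rw [hu.initial n hn, hv.initial n hn])]
      simp [tau]) t
  simpa [pathWeight] using h

theorem unique {v : ℕ → ℝ → ℝ} (hu : IsVolterraStepSolution u)
    (hv : IsVolterraStepSolution v) : u = v := by
  have h0 : u 0 = v 0 := funext fun t => by rw [hu.boundary, hv.boundary]
  have h1 : u 1 = v 1 := by
    funext t
    have h := (hu.hasDerivAt_tau t).unique (tau_unique hu hv ▸ hv.hasDerivAt_tau t)
    exact mul_left_cancel₀ (Real.exp_ne_zero _) h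
  have h : ∀ n, u n = v n ∧ u (n + 1) = v (n + 1) := by
    intro n
    induction n with
    | zero => exact ⟨h0, h1⟩
    | succ n ih =>
      refine ⟨ih.2, funext fun t => ?_⟩
      have h := (hu.chain (n + 1) (by omega) t).unique (ih.2 ▸ hv.chain (n + 1) (by omega) t)
      have h' := mul_left_cancel₀ (hu.pos (by omega) t).ne' h
      simp only [Nat.add_sub_cancel, ih.1] at h'
      linarith
  exact funext fun n => (h n).1

end IsVolterraStepSolution

/-! ### Orthogonal polynomials of a symmetric moment functional -/

section OrthogonalPolynomials

open Polynomial

/-- The monic orthogonal polynomials of a symmetric functional, given by their three-term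
recurrence. -/
noncomputable def orthoPoly (L : ℝ[X] →ₗ[ℝ] ℝ) : ℕ → ℝ[X]
  | 0 => 1
  | 1 => X
  | n + 2 => X * orthoPoly L (n + 1) -
      C (L (orthoPoly L (n + 1) * X ^ (n + 1)) / L (orthoPoly L n * X ^ n)) * orthoPoly L n

/-- The mixed moments `L(P_n X^k)`. -/
noncomputable def mixedMoment (L : ℝ[X] →ₗ[ℝ] ℝ) (n k : ℕ) : ℝ := L (orthoPoly L n * X ^ k)

/-- The recurrence coefficients of the orthogonal polynomials. -/
noncomputable def recCoeff (L : ℝ[X] →ₗ[ℝ] ℝ) : ℕ → ℝ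
  | 0 => 0
  | n + 1 => mixedMoment L (n + 1) (n + 1) / mixedMoment L n n

variable (L : ℝ[X] →ₗ[ℝ] ℝ)

theorem orthoPoly_succ (n : ℕ) :
    orthoPoly L (n + 1) = X * orthoPoly L n - C (recCoeff L n) * orthoPoly L (n - 1) := by
  cases n with
  | zero => simp [orthoPoly, recCoeff]
  | succ n => rfl

theorem orthoPoly_monic_natDegree (n : ℕ) :
    (orthoPoly L n).Monic ∧ (orthoPoly L n).natDegree = n := by
  induction n using Nat.twoStepInduction with
  | zero => simp [orthoPoly]
  | one => simp [orthoPoly]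
  | more n ih0 ih1 =>
    rw [orthoPoly_succ, Nat.add_sub_cancel]
    have hm : (X * orthoPoly L (n + 1)).Monic := monic_X.mul ih1.1
    have hd : (X * orthoPoly L (n + 1)).natDegree = n + 2 := by
      rw [monic_X.natDegree_mul ih1.1, natDegree_X, ih1.2]; ring
    have hlt : (C (recCoeff L (n + 1)) * orthoPoly L n).degree
        < (X * orthoPoly L (n + 1)).degree := by
      rw [degree_eq_natDegree hm.ne_zero, hd]
      refine lt_of_le_of_lt degree_le_natDegree ?_
      have := (natDegree_C_mul_le (recCoeff L (n + 1)) (orthoPoly L n))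
      rw [ih0.2] at this
      exact_mod_cast (by omega : (C (recCoeff L (n + 1)) * orthoPoly L n).natDegree < n + 2)
    refine ⟨hm.sub_of_left hlt, ?_⟩
    rw [natDegree_sub_eq_left_of_natDegree_lt, hd]
    rw [hd]
    have := (natDegree_C_mul_le (recCoeff L (n + 1)) (orthoPoly L n))
    omega

theorem mixedMoment_succ (n k : ℕ) :
    mixedMoment L (n + 1) k
      = mixedMoment L n (k + 1) - recCoeff L n * mixedMoment L (n - 1) k := by
  rw [mixedMoment, orthoPoly_succ, mixedMoment, mixedMoment, ← smul_eq_mul (recCoeff L n),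
    ← map_smul, ← map_sub]
  congr 1
  rw [smul_eq_C_mul]
  ring

variable {L}

theorem mixedMoment_eq_zero_of_odd (hodd : ∀ k, Odd k → L (X ^ k) = 0) (n k : ℕ)
    (h : Odd (n + k)) : mixedMoment L n k = 0 := by
  induction n using Nat.twoStepInduction generalizing k with
  | zero => simpa [mixedMoment, orthoPoly] using hodd k (by simpa using h)
  | one =>
    rw [mixedMoment, orthoPoly, ← pow_succ']
    exact hodd _ (by rwa [add_comm])
  | more n ih0 ih1 =>
    rw [mixedMoment_succ, Nat.add_sub_cancel, ih1 (k + 1) (by convert h using 1; ring),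
      ih0 k (by simp only [Nat.odd_iff] at h ⊢; omega)]
    simp

/-- Orthogonality is assumed at this one `n` only, so that the lemma is available inside the
induction that proves orthogonality. -/
theorem map_orthoPoly_mul_eq_zero_of_mixedMoment {n : ℕ}
    (h : ∀ k < n, mixedMoment L n k = 0) {q : ℝ[X]} (hq : q.degree < n) :
    L (orthoPoly L n * q) = 0 := by
  rcases Nat.eq_zero_or_pos n with rfl | hn
  · rw [degree_eq_bot.mp (Nat.WithBot.lt_zero_iff.mp hq)]
    simp
  have hq' : q.natDegree < n := by
    rcases eq_or_ne q 0 with rfl | h0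
    · simpa using hn
    · exact (natDegree_lt_iff_degree_lt h0).mpr hq
  rw [q.as_sum_range' n hq', Finset.mul_sum, map_sum]
  refine Finset.sum_eq_zero fun k hk => ?_
  rw [← C_mul_X_pow_eq_monomial, mul_left_comm, ← smul_eq_C_mul, map_smul]
  have := h k (Finset.mem_range.mp hk)
  rw [mixedMoment] at this
  rw [this, smul_zero]

theorem mixedMoment_self_eq_of_orthogonal {n : ℕ} (h : ∀ k < n, mixedMoment L n k = 0) :
    mixedMoment L n n = L (orthoPoly L n * orthoPoly L n) := by
  obtain ⟨hm, hd⟩ := orthoPoly_monic_natDegree L n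
  have hlt : (orthoPoly L n - X ^ n).degree < ((n : ℕ) : WithBot ℕ) := by
    have := degree_sub_lt_left (p := orthoPoly L n) (q := X ^ n)
      (by rw [degree_eq_natDegree hm.ne_zero, hd, degree_X_pow]) hm.ne_zero
      (by rw [hm.leadingCoeff, (monic_X_pow n).leadingCoeff])
    rwa [degree_eq_natDegree hm.ne_zero, hd] at this
  have := map_orthoPoly_mul_eq_zero_of_mixedMoment h hlt
  rw [mul_sub, map_sub, sub_eq_zero] at this
  exact this.symm

/-- In the step to `n + 2`, both terms vanish for `k < n`; at `k = n` the recurrence coefficient is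
chosen to cancel them, its denominator being nonzero by positivity; at `k = n + 1` parity applies.
-/
theorem mixedMoment_eq_zero_of_lt (hodd : ∀ k, Odd k → L (X ^ k) = 0)
    (hpos : ∀ q : ℝ[X], q ≠ 0 → 0 < L (q * q)) {n k : ℕ} (hk : k < n) :
    mixedMoment L n k = 0 := by
  induction n using Nat.twoStepInduction generalizing k with
  | zero => omega
  | one => exact mixedMoment_eq_zero_of_odd hodd 1 k (by rw [Nat.lt_one_iff.mp hk]; decide)
  | more n ih0 ih1 =>
    rw [mixedMoment_succ, Nat.add_sub_cancel]
    rcases lt_trichotomy k n with h | rfl | h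
    · rw [ih1 (by omega), ih0 h]; simp
    · have hk0 : mixedMoment L k k ≠ 0 := by
        rw [mixedMoment_self_eq_of_orthogonal fun _ => ih0]
        exact (hpos _ (orthoPoly_monic_natDegree L k).1.ne_zero).ne'
      rw [recCoeff, div_mul_cancel₀ _ hk0, sub_self]
    · obtain rfl : k = n + 1 := by omega
      rw [mixedMoment_eq_zero_of_odd hodd (n + 1) (n + 1 + 1)
          (by simp only [Nat.odd_iff]; omega),
        mixedMoment_eq_zero_of_odd hodd n (n + 1) (by simp only [Nat.odd_iff]; omega)]
      simp

theorem mixedMoment_self (hodd : ∀ k, Odd k → L (X ^ k) = 0)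
    (hpos : ∀ q : ℝ[X], q ≠ 0 → 0 < L (q * q)) (n : ℕ) :
    mixedMoment L n n = L (orthoPoly L n * orthoPoly L n) :=
  mixedMoment_self_eq_of_orthogonal fun _ => mixedMoment_eq_zero_of_lt hodd hpos

theorem mixedMoment_self_pos (hodd : ∀ k, Odd k → L (X ^ k) = 0)
    (hpos : ∀ q : ℝ[X], q ≠ 0 → 0 < L (q * q)) (n : ℕ) : 0 < mixedMoment L n n := by
  rw [mixedMoment_self hodd hpos]
  exact hpos _ (orthoPoly_monic_natDegree L n).1.ne_zero

theorem map_orthoPoly_mul_eq_zero (hodd : ∀ k, Odd k → L (X ^ k) = 0)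
    (hpos : ∀ q : ℝ[X], q ≠ 0 → 0 < L (q * q)) {n : ℕ} {q : ℝ[X]} (hq : q.degree < n) :
    L (orthoPoly L n * q) = 0 :=
  map_orthoPoly_mul_eq_zero_of_mixedMoment (fun _ => mixedMoment_eq_zero_of_lt hodd hpos) hq

theorem recCoeff_succ_mul (hpos : ∀ n, mixedMoment L n n ≠ 0) (n : ℕ) :
    recCoeff L (n + 1) * mixedMoment L n n = mixedMoment L (n + 1) (n + 1) :=
  div_mul_cancel₀ _ (hpos n)

end OrthogonalPolynomials

/-! ### Moment functionals evolving by the Volterra flow -/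

section Flow

open Polynomial

variable {L : ℝ → ℝ[X] →ₗ[ℝ] ℝ}

/-- The squared norms have logarithmic derivative `recCoeff (n+1) + recCoeff n`; taking quotients of
consecutive norms gives the chain. -/
theorem hasDerivAt_mixedMoment_self {n : ℕ} {t : ℝ} (hpos : ∀ n, mixedMoment (L t) n n ≠ 0)
    (h : ∀ k, HasDerivAt (fun t => mixedMoment (L t) n k)
      (mixedMoment (L t) n (k + 2)
        - recCoeff (L t) n * recCoeff (L t) (n - 1) * mixedMoment (L t) (n - 2) k) t) :
    HasDerivAt (fun t => mixedMoment (L t) n n)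
      (mixedMoment (L t) n n * (recCoeff (L t) (n + 1) + recCoeff (L t) n)) t := by
  refine (h n).congr_deriv ?_
  have h1 := mixedMoment_succ (L t) n (n + 1)
  have h2 := recCoeff_succ_mul hpos n
  cases n with
  | zero =>
    simp only [recCoeff, zero_mul, sub_zero, add_zero] at h1 h2 ⊢
    linarith
  | succ m =>
    have h3 := mixedMoment_succ (L t) m (m + 1)
    simp only [Nat.add_sub_cancel] at h1 ⊢
    have e1 : m + 1 - 2 = m - 1 := by omega
    rw [e1]
    linear_combination (-1 : ℝ) * h1 - h2 - recCoeff (L t) (m + 1) * h3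

theorem hasDerivAt_recCoeff {n : ℕ} {t : ℝ} (hpos : ∀ n, mixedMoment (L t) n n ≠ 0)
    (h0 : HasDerivAt (fun t => mixedMoment (L t) n n)
      (mixedMoment (L t) n n * (recCoeff (L t) (n + 1) + recCoeff (L t) n)) t)
    (h1 : HasDerivAt (fun t => mixedMoment (L t) (n + 1) (n + 1))
      (mixedMoment (L t) (n + 1) (n + 1) * (recCoeff (L t) (n + 2) + recCoeff (L t) (n + 1))) t) :
    HasDerivAt (fun t => recCoeff (L t) (n + 1))
      (recCoeff (L t) (n + 1) * (recCoeff (L t) (n + 2) - recCoeff (L t) n)) t := by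
  refine (h1.div h0 (hpos n)).congr_deriv ?_
  have := hpos n
  rw [show recCoeff (L t) (n + 1) = mixedMoment (L t) (n + 1) (n + 1) / mixedMoment (L t) n n
    from rfl]
  field_simp
  ring

/-- This expresses that the time derivative of `P_n` is `-u_n u_{n-1} P_{n-2}`. The formula at `n`
and `n + 1` yields the chain equation for `recCoeff (n+1)`, which is what differentiating the
recurrence for `n + 2` requires. The truncated subtractions are harmless since `recCoeff` vanishes
at `0`. -/
theorem hasDerivAt_mixedMoment {t : ℝ} (hpos : ∀ n, mixedMoment (L t) n n ≠ 0)
    (hL : ∀ k, HasDerivAt (fun t => L t (X ^ k)) (L t (X ^ (k + 2))) t) (n : ℕ) :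
    ∀ k, HasDerivAt (fun t => mixedMoment (L t) n k)
      (mixedMoment (L t) n (k + 2)
        - recCoeff (L t) n * recCoeff (L t) (n - 1) * mixedMoment (L t) (n - 2) k) t := by
  induction n using Nat.twoStepInduction with
  | zero =>
    intro k
    simpa [mixedMoment, orthoPoly, recCoeff] using hL k
  | one =>
    intro k
    have h0 : recCoeff (L t) (1 - 1) = 0 := rfl
    rw [h0, mul_zero, zero_mul, sub_zero]
    simp only [mixedMoment, orthoPoly, ← pow_succ']
    exact hL (k + 1)
  | more n ih0 ih1 =>
    intro k
    have hu := hasDerivAt_recCoeff hpos (hasDerivAt_mixedMoment_self hpos ih0)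
      (hasDerivAt_mixedMoment_self hpos ih1)
    have hs : (fun t => mixedMoment (L t) (n + 2) k) = fun t =>
        mixedMoment (L t) (n + 1) (k + 1) - recCoeff (L t) (n + 1) * mixedMoment (L t) n k := by
      funext t
      exact mixedMoment_succ (L t) (n + 1) k
    rw [hs]
    refine ((ih1 (k + 1)).sub (hu.mul (ih0 k))).congr_deriv ?_
    have h1 := mixedMoment_succ (L t) (n + 1) (k + 2)
    simp only [Nat.add_sub_cancel, show n + 2 - 1 = n + 1 by omega,
      show n + 1 - 2 = n - 1 by omega] at h1 ⊢
    rw [h1]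
    cases n with
    | zero => simp [recCoeff]; ring
    | succ m =>
      have h2 := mixedMoment_succ (L t) m k
      simp only [Nat.add_sub_cancel, show m + 1 - 2 = m - 1 by omega]
      rw [h2]
      ring

theorem volterra_of_moment_flow {t : ℝ} (hpos : ∀ n, mixedMoment (L t) n n ≠ 0)
    (hL : ∀ k, HasDerivAt (fun t => L t (X ^ k)) (L t (X ^ (k + 2))) t) (n : ℕ) :
    HasDerivAt (fun t => recCoeff (L t) (n + 1))
      (recCoeff (L t) (n + 1) * (recCoeff (L t) (n + 2) - recCoeff (L t) n)) t :=
  hasDerivAt_recCoeff hpos (hasDerivAt_mixedMoment_self hpos (hasDerivAt_mixedMoment hpos hL n))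
    (hasDerivAt_mixedMoment_self hpos (hasDerivAt_mixedMoment hpos hL (n + 1)))

end Flow

/-! ### The evolving semicircle functional and existence -/

section Semicircle

open Polynomial Real

/-- Integration against `exp (t x ^ 2)` times the semicircle weight on `[-2, 2]`, written with
`x = 2 cos θ` and up to a constant factor. -/
noncomputable def semicircleFunctional (t : ℝ) : ℝ[X] →ₗ[ℝ] ℝ where
  toFun q := ∫ θ in (0 : ℝ)..π, q.eval (2 * cos θ) * (exp (t * (2 * cos θ) ^ 2) * sin θ ^ 2)
  map_add' p q := by
    rw [← intervalIntegral.integral_add]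
    · simp only [eval_add, add_mul]
    all_goals exact Continuous.intervalIntegrable (by fun_prop) _ _
  map_smul' c q := by
    rw [RingHom.id_apply, smul_eq_mul, ← intervalIntegral.integral_const_mul]
    simp only [eval_smul, smul_eq_mul, mul_assoc]

theorem semicircleFunctional_apply (t : ℝ) (q : ℝ[X]) : semicircleFunctional t q =
    ∫ θ in (0 : ℝ)..π, q.eval (2 * cos θ) * (exp (t * (2 * cos θ) ^ 2) * sin θ ^ 2) := rfl

theorem semicircleFunctional_odd (t : ℝ) (k : ℕ) (hk : Odd k) :
    semicircleFunctional t (X ^ k) = 0 := by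
  have h := intervalIntegral.integral_comp_sub_left (a := 0) (b := π)
    (fun θ => (X ^ k : ℝ[X]).eval (2 * cos θ) * (exp (t * (2 * cos θ) ^ 2) * sin θ ^ 2)) π
  rw [sub_self, sub_zero, ← semicircleFunctional_apply] at h
  have h2 : ∀ θ, (X ^ k : ℝ[X]).eval (2 * cos (π - θ))
      * (exp (t * (2 * cos (π - θ)) ^ 2) * sin (π - θ) ^ 2)
      = -((X ^ k : ℝ[X]).eval (2 * cos θ) * (exp (t * (2 * cos θ) ^ 2) * sin θ ^ 2)) := by
    intro θ
    rw [cos_pi_sub, sin_pi_sub, mul_neg, neg_sq, eval_pow, eval_X, hk.neg_pow, eval_pow, eval_X]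
    ring
  simp only [h2, intervalIntegral.integral_neg, ← semicircleFunctional_apply] at h
  linarith

theorem semicircleFunctional_pos (t : ℝ) (q : ℝ[X]) (hq : q ≠ 0) :
    0 < semicircleFunctional t (q * q) := by
  have hx : ∃ x ∈ Set.Ioo (-2 : ℝ) 2, ¬ q.IsRoot x := by
    by_contra! h
    exact hq (eq_zero_of_infinite_isRoot q ((Set.Ioo_infinite (by norm_num)).mono h))
  obtain ⟨x, hx, hroot⟩ := hx
  have hcos : cos (arccos (x / 2)) = x / 2 :=
    cos_arccos (by linarith [hx.1]) (by linarith [hx.2])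
  have hsin : 0 < sin (arccos (x / 2)) := by
    rw [sin_arccos]
    refine sqrt_pos.mpr ?_
    nlinarith [hx.1, hx.2]
  rw [semicircleFunctional_apply]
  refine intervalIntegral.integral_pos pi_pos (by fun_prop) (fun θ _ => ?_)
    ⟨arccos (x / 2), ⟨arccos_nonneg _, arccos_le_pi _⟩, ?_⟩
  · rw [eval_mul]
    exact mul_nonneg (mul_self_nonneg _) (by positivity)
  · rw [eval_mul, hcos, mul_div_cancel₀ x two_ne_zero]
    exact mul_pos (mul_self_pos.mpr hroot) (by positivity)

theorem hasDerivAt_semicircleFunctional (t : ℝ) (k : ℕ) :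
    HasDerivAt (fun t => semicircleFunctional t (X ^ k))
      (semicircleFunctional t (X ^ (k + 2))) t := by
  simp only [semicircleFunctional_apply, eval_pow, eval_X]
  refine (intervalIntegral.hasDerivAt_integral_of_dominated_loc_of_deriv_le
    (F := fun t θ => (2 * cos θ) ^ k * (exp (t * (2 * cos θ) ^ 2) * sin θ ^ 2))
    (F' := fun t θ => (2 * cos θ) ^ (k + 2) * (exp (t * (2 * cos θ) ^ 2) * sin θ ^ 2))
    (bound := fun _ => 2 ^ (k + 2) * exp ((|t| + 1) * 4)) (Metric.ball_mem_nhds t one_pos)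
    (Eventually.of_forall fun x => Continuous.aestronglyMeasurable (by fun_prop))
    (Continuous.intervalIntegrable (by fun_prop) _ _)
    (Continuous.aestronglyMeasurable (by fun_prop)) ?_
    (Continuous.intervalIntegrable (by fun_prop) _ _) ?_).2
  · refine Eventually.of_forall fun θ _ x hx => ?_
    have hx' : x ≤ |t| + 1 := by
      rw [Metric.mem_ball, Real.dist_eq] at hx
      linarith [le_abs_self t, (abs_lt.mp hx).2]
    have hc : |2 * cos θ| ≤ 2 := by
      rw [abs_mul, abs_two]
      linarith [abs_cos_le_one θ]
    have hc2 : (2 * cos θ) ^ 2 ≤ 4 := by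
      rw [← sq_abs]
      nlinarith [abs_nonneg (2 * cos θ)]
    rw [norm_mul, norm_pow, norm_eq_abs, norm_eq_abs,
      abs_of_nonneg (show 0 ≤ exp (x * (2 * cos θ) ^ 2) * sin θ ^ 2 by positivity)]
    have hs : sin θ ^ 2 ≤ 1 := sin_sq_le_one θ
    have he : exp (x * (2 * cos θ) ^ 2) ≤ exp ((|t| + 1) * 4) := by
      refine exp_le_exp.mpr ?_
      calc x * (2 * cos θ) ^ 2 ≤ (|t| + 1) * (2 * cos θ) ^ 2 := by gcongr
        _ ≤ (|t| + 1) * 4 := by gcongr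
    calc |2 * cos θ| ^ (k + 2) * (exp (x * (2 * cos θ) ^ 2) * sin θ ^ 2)
        ≤ 2 ^ (k + 2) * (exp ((|t| + 1) * 4) * 1) := by gcongr
      _ = _ := by rw [mul_one]
  · refine Eventually.of_forall fun θ _ x _ => ?_
    refine ((((hasDerivAt_mul_const ((2 * cos θ) ^ 2)).exp).mul_const (sin θ ^ 2)).const_mul
      ((2 * cos θ) ^ k)).congr_deriv ?_
    ring

theorem integral_sin_natCast_mul_sq (n : ℕ) :
    ∫ θ in (0 : ℝ)..π, sin ((n + 1 : ℝ) * θ) ^ 2 = π / 2 := by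
  have hn : (n + 1 : ℝ) ≠ 0 := by positivity
  have h := intervalIntegral.integral_comp_mul_left (a := 0) (b := π)
    (fun x => sin x ^ 2) hn
  rw [h, integral_sin_sq]
  have : sin ((n + 1 : ℝ) * π) = 0 := by exact_mod_cast sin_nat_mul_pi (n + 1)
  rw [this]
  simp
  field_simp

/-- The sine formulas at `n` and `n + 1` give equal squared norms `π / 2`, hence coefficient `1`,
hence the sine formula at `n + 2` by the addition theorem. -/
theorem orthoPoly_semicircle_zero (n : ℕ) (θ : ℝ) :
    (orthoPoly (semicircleFunctional 0) n).eval (2 * cos θ) * sin θ = sin ((n + 1 : ℝ) * θ) ∧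
    recCoeff (semicircleFunctional 0) (n + 1) = 1 := by
  have hself : ∀ n, (∀ θ, (orthoPoly (semicircleFunctional 0) n).eval (2 * cos θ) * sin θ
      = sin ((n + 1 : ℝ) * θ)) → mixedMoment (semicircleFunctional 0) n n = π / 2 := by
    intro n h
    rw [mixedMoment_self (semicircleFunctional_odd 0) (semicircleFunctional_pos 0),
      semicircleFunctional_apply, ← integral_sin_natCast_mul_sq n]
    refine intervalIntegral.integral_congr fun θ _ => ?_
    simp only [← h θ, zero_mul, exp_zero, eval_mul]
    ring
  have hpair : ∀ n, (∀ θ, (orthoPoly (semicircleFunctional 0) n).eval (2 * cos θ) * sin θ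
      = sin ((n + 1 : ℝ) * θ)) → (∀ θ, (orthoPoly (semicircleFunctional 0) (n + 1)).eval
      (2 * cos θ) * sin θ = sin (((n + 1 : ℕ) + 1 : ℝ) * θ)) →
      recCoeff (semicircleFunctional 0) (n + 1) = 1 := by
    intro n h0 h1
    rw [recCoeff, hself n h0, hself (n + 1) h1, div_self (by positivity)]
  have hmain : ∀ n, ∀ θ, (orthoPoly (semicircleFunctional 0) n).eval (2 * cos θ) * sin θ
      = sin ((n + 1 : ℝ) * θ) := by
    intro n
    induction n using Nat.twoStepInduction with
    | zero => intro θ; simp [orthoPoly]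
    | one =>
      intro θ
      simp only [orthoPoly, eval_X, Nat.cast_one]
      rw [show (1 + 1 : ℝ) * θ = 2 * θ by ring, sin_two_mul]
      ring
    | more n ih0 ih1 =>
      intro θ
      rw [orthoPoly_succ, hpair n ih0 ih1, Nat.add_sub_cancel]
      simp only [C_1, one_mul, eval_sub, eval_mul, eval_X]
      rw [sub_mul, mul_assoc, ih0, ih1]
      push_cast
      rw [show (n + 1 : ℝ) * θ = (n + 1 + 1) * θ - θ by ring,
        show (n + 2 + 1 : ℝ) * θ = (n + 1 + 1) * θ + θ by ring, sin_sub, sin_add]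
      ring
  exact ⟨hmain n θ, hpair n (hmain n) (hmain (n + 1))⟩

theorem isVolterraStepSolution_recCoeff :
    IsVolterraStepSolution fun n t => recCoeff (semicircleFunctional t) n where
  boundary _ := rfl
  initial n hn := by
    obtain ⟨m, rfl⟩ := Nat.exists_eq_succ_of_ne_zero (by omega : n ≠ 0)
    exact (orthoPoly_semicircle_zero m 0).2
  chain n hn t := by
    obtain ⟨m, rfl⟩ := Nat.exists_eq_succ_of_ne_zero (by omega : n ≠ 0)
    exact volterra_of_moment_flow
      (fun n => (mixedMoment_self_pos (semicircleFunctional_odd t)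
        (semicircleFunctional_pos t) n).ne')
      (hasDerivAt_semicircleFunctional t) m

end Semicircle

/-! ### First-order approximation -/

/-- `f = c + O(1 / t)` along `l`. -/
def ApproxConst (l : Filter ℝ) (f : ℝ → ℝ) (c : ℝ) : Prop :=
  (fun t => f t - c) =O[l] (fun t => t⁻¹)

namespace ApproxConst

variable {l : Filter ℝ} {f g : ℝ → ℝ} {c d : ℝ}

theorem const (l : Filter ℝ) (c : ℝ) : ApproxConst l (fun _ => c) c := by
  simpa [ApproxConst] using isBigO_zero _ _

theorem congr' (hf : ApproxConst l f c) (h : f =ᶠ[l] g) : ApproxConst l g c :=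
  IsBigO.congr' hf (h.mono fun t ht => by simp only [ht]) EventuallyEq.rfl

theorem of_eq (hf : ApproxConst l f c) (h : c = d) : ApproxConst l f d := h ▸ hf

theorem inv_id (l : Filter ℝ) : ApproxConst l (fun t => t⁻¹) 0 := by
  simpa [ApproxConst] using isBigO_refl _ _

theorem add (hf : ApproxConst l f c) (hg : ApproxConst l g d) :
    ApproxConst l (fun t => f t + g t) (c + d) :=
  (IsBigO.add hf hg).congr_left fun t => by ring

theorem sub (hf : ApproxConst l f c) (hg : ApproxConst l g d) :
    ApproxConst l (fun t => f t - g t) (c - d) :=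
  (IsBigO.sub hf hg).congr_left fun t => by ring

theorem tendsto (hl : Tendsto (fun t : ℝ => t⁻¹) l (nhds 0)) (hf : ApproxConst l f c) :
    Tendsto f l (nhds c) := by
  simpa using (IsBigO.trans_tendsto hf hl).add_const c

theorem mul (hl : Tendsto (fun t : ℝ => t⁻¹) l (nhds 0)) (hf : ApproxConst l f c)
    (hg : ApproxConst l g d) : ApproxConst l (fun t => f t * g t) (c * d) := by
  have h1 : (fun t => (f t - c) * g t) =O[l] (fun t => t⁻¹) := by
    simpa using IsBigO.mul hf ((hg.tendsto hl).isBigO_one ℝ)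
  exact (h1.add (IsBigO.const_mul_left hg c)).congr_left fun t => by ring

theorem eventually_ne (hl : Tendsto (fun t : ℝ => t⁻¹) l (nhds 0)) (hf : ApproxConst l f c)
    (hc : c ≠ 0) : ∀ᶠ t in l, f t ≠ 0 :=
  (hf.tendsto hl).eventually_ne hc

theorem inv (hl : Tendsto (fun t : ℝ => t⁻¹) l (nhds 0)) (hf : ApproxConst l f c) (hc : c ≠ 0) :
    ApproxConst l (fun t => (f t)⁻¹) c⁻¹ := by
  have h1 : (fun t => (f t - c) * ((f t)⁻¹ * (-c⁻¹))) =O[l] (fun t => t⁻¹) := by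
    simpa using IsBigO.mul hf ((((hf.tendsto hl).inv₀ hc).mul_const (-c⁻¹)).isBigO_one ℝ)
  refine h1.congr' ((hf.eventually_ne hl hc).mono fun t ht => ?_) EventuallyEq.rfl
  field_simp
  ring

theorem div (hl : Tendsto (fun t : ℝ => t⁻¹) l (nhds 0)) (hf : ApproxConst l f c)
    (hg : ApproxConst l g d) (hd : d ≠ 0) : ApproxConst l (fun t => f t / g t) (c / d) := by
  simpa only [div_eq_mul_inv] using hf.mul hl (hg.inv hl hd)

end ApproxConst

/-! ### Stability of the Laguerre recurrence -/

theorem cast_descFactorial_succ (k m : ℕ) :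
    (k.descFactorial (m + 1) : ℝ) = (k - m) * k.descFactorial m := by
  rw [Nat.descFactorial_succ]
  rcases le_or_gt m k with h | h
  · push_cast [h]
    ring
  · simp [Nat.descFactorial_of_lt h]

/-- For exact Laguerre moments, the `n`-th monic polynomial paired with `y ^ k` gives
`k.descFactorial n * M k`; the induction carries this limit. The vanishing for `k < n` lets `B` and
`A` be solved from the recurrence as quotients with nonzero limiting denominators. -/
theorem approxConst_laguerre_recurrence {l : Filter ℝ}
    (hl : Tendsto (fun t : ℝ => t⁻¹) l (nhds 0)) {σ : ℕ → ℕ → ℝ → ℝ} {A B : ℕ → ℝ → ℝ}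
    {M : ℕ → ℝ} {α : ℝ} (hM0 : ∀ k, M k ≠ 0) (hM : ∀ k : ℕ, M (k + 1) = (k + 1 + α) * M k)
    (hB0 : ∀ t, B 0 t = 0) (h0 : ∀ k, ApproxConst l (σ 0 k) (M k))
    (hrec : ∀ n k t,
      σ (n + 1) k t = σ n (k + 1) t - A n t * σ n k t - B n t * σ (n - 1) k t)
    (hz : ∀ n k, k < n → ∀ t, σ n k t = 0) (n : ℕ) :
    ApproxConst l (A n) (2 * n + 1 + α) ∧ ApproxConst l (B n) (n * (n + α)) := by
  have hAB0 : ApproxConst l (A 0) (1 + α) := by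
    refine (((h0 1).div hl (h0 0) (hM0 0)).congr' ?_).of_eq ?_
    · filter_upwards [(h0 0).eventually_ne hl (hM0 0)] with t ht
      have h1 := hrec 0 0 t
      rw [hz 1 0 one_pos t, hB0] at h1
      rw [div_eq_iff ht]
      linarith
    · rw [hM 0, mul_div_cancel_right₀ _ (hM0 0)]
      push_cast
      ring
  have step : ∀ n, (∀ k, ApproxConst l (σ n k) (k.descFactorial n * M k)) →
      (∀ k, ApproxConst l (σ (n + 1) k) (k.descFactorial (n + 1) * M k)) →
      ApproxConst l (A (n + 1)) (2 * (n + 1) + 1 + α) ∧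
      ApproxConst l (B (n + 1)) ((n + 1) * (n + 1 + α)) := by
    intro n hn hn1
    have hf0 : (n.factorial : ℝ) ≠ 0 := by positivity
    have hne : (n.descFactorial n * M n : ℝ) ≠ 0 := by
      rw [Nat.descFactorial_self]
      exact mul_ne_zero hf0 (hM0 n)
    have hne1 : ((n + 1).descFactorial (n + 1) * M (n + 1) : ℝ) ≠ 0 := by
      rw [Nat.descFactorial_self]
      exact mul_ne_zero (by positivity) (hM0 _)
    have hB : ApproxConst l (B (n + 1)) ((n + 1) * (n + 1 + α)) := by
      refine (((hn1 (n + 1)).div hl (hn n) hne).congr' ?_).of_eq ?_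
      · filter_upwards [(hn n).eventually_ne hl hne] with t ht
        have h1 := hrec (n + 1) n t
        rw [hz _ n (by omega), hz (n + 1) n (by omega), Nat.add_sub_cancel] at h1
        rw [div_eq_iff ht]
        linarith
      · rw [div_eq_iff hne, hM n, Nat.descFactorial_self, Nat.descFactorial_self,
          Nat.factorial_succ]
        push_cast
        ring
    refine ⟨?_, hB⟩
    refine ((((hn1 (n + 2)).sub (hB.mul hl (hn (n + 1)))).div hl (hn1 (n + 1)) hne1).congr'
      ?_).of_eq ?_
    · filter_upwards [(hn1 (n + 1)).eventually_ne hl hne1] with t ht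
      have h1 := hrec (n + 1) (n + 1) t
      rw [hz _ (n + 1) (by omega), Nat.add_sub_cancel] at h1
      rw [div_eq_iff ht]
      linarith
    · rw [div_eq_iff hne1, hM (n + 1), cast_descFactorial_succ (n + 1) n,
        Nat.succ_descFactorial_succ (n + 1) n]
      push_cast
      ring
  have hσ : ∀ n, (∀ k, ApproxConst l (σ n k) (k.descFactorial n * M k)) ∧
      (∀ k, ApproxConst l (σ (n + 1) k) (k.descFactorial (n + 1) * M k)) := by
    intro n
    induction n with
    | zero =>
      have hz0 : ∀ k, ApproxConst l (σ 0 k) (k.descFactorial 0 * M k) := fun k =>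
        (h0 k).of_eq (by simp)
      refine ⟨hz0, fun k => ?_⟩
      refine (((h0 (k + 1)).sub (hAB0.mul hl (h0 k))).congr' (Eventually.of_forall fun t => ?_)
        ).of_eq ?_
      · simp only [hrec 0 k t, hB0, zero_mul, sub_zero]
      · rw [cast_descFactorial_succ, hM k]
        simp only [Nat.descFactorial_zero]
        push_cast
        ring
    | succ n ih =>
      refine ⟨ih.2, fun k => ?_⟩
      obtain ⟨hA, hB⟩ := step n ih.1 ih.2
      refine ((((ih.2 (k + 1)).sub (hA.mul hl (ih.2 k))).sub (hB.mul hl (ih.1 k))).congr'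
        (Eventually.of_forall fun t => ?_)).of_eq ?_
      · simp only [hrec (n + 1) k t, Nat.add_sub_cancel]
      · rw [Nat.succ_descFactorial_succ, cast_descFactorial_succ k (n + 1),
          cast_descFactorial_succ k n, hM k]
        push_cast
        ring
  cases n with
  | zero => exact ⟨by simpa using hAB0, by simpa [funext hB0] using ApproxConst.const l 0⟩
  | succ n => simpa using step n (hσ n).1 (hσ n).2

/-! ### The integrals `∫ (τ sin² θ)^k exp (-τ sin² θ)` -/

section SinIntegral

open Real

noncomputable def sinIntegral (k : ℕ) (τ : ℝ) : ℝ :=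
  ∫ θ in (0 : ℝ)..π, (τ * sin θ ^ 2) ^ k * exp (-(τ * sin θ ^ 2))

/-- Integrate the derivative of `τ z^k sin θ cos θ exp (-z)`, `z = τ sin² θ`, which vanishes at both
endpoints. -/
theorem sinIntegral_recurrence (k : ℕ) (τ : ℝ) :
    τ * (2 * k + 1) * sinIntegral k τ - (2 * k + 2) * sinIntegral (k + 1) τ
      - 2 * τ * sinIntegral (k + 1) τ + 2 * sinIntegral (k + 2) τ = 0 := by
  have hd : ∀ θ : ℝ, HasDerivAt
      (fun θ => τ * ((τ * sin θ ^ 2) ^ k * (sin θ * cos θ) * exp (-(τ * sin θ ^ 2))))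
      (τ * (2 * k + 1) * ((τ * sin θ ^ 2) ^ k * exp (-(τ * sin θ ^ 2)))
        - (2 * k + 2) * ((τ * sin θ ^ 2) ^ (k + 1) * exp (-(τ * sin θ ^ 2)))
        - 2 * τ * ((τ * sin θ ^ 2) ^ (k + 1) * exp (-(τ * sin θ ^ 2)))
        + 2 * ((τ * sin θ ^ 2) ^ (k + 2) * exp (-(τ * sin θ ^ 2)))) θ := by
    intro θ
    have hz := ((hasDerivAt_sin θ).pow 2).const_mul τ
    have hsc := (hasDerivAt_sin θ).mul (hasDerivAt_cos θ)
    refine ((((hz.pow k).mul hsc).mul hz.neg.exp).const_mul τ).congr_deriv ?_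
    have hc : cos θ ^ 2 = 1 - sin θ ^ 2 := by rw [← sin_sq_add_cos_sq θ]; ring
    cases k with
    | zero =>
      simp
      ring_nf
      rw [hc]
      ring
    | succ k =>
      simp
      ring_nf
      rw [hc]
      ring
  have h := intervalIntegral.integral_eq_sub_of_hasDerivAt (a := 0) (b := π)
    (fun θ _ => hd θ) (Continuous.intervalIntegrable (by fun_prop) _ _)
  rw [intervalIntegral.integral_add, intervalIntegral.integral_sub, intervalIntegral.integral_sub]
    at h
  · simpa [intervalIntegral.integral_const_mul, sinIntegral] using h
  all_goals exact Continuous.intervalIntegrable (by fun_prop) _ _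

theorem sinIntegral_nonneg (k : ℕ) {τ : ℝ} (hτ : 0 ≤ τ) : 0 ≤ sinIntegral k τ :=
  intervalIntegral.integral_nonneg pi_pos.le fun θ _ => by positivity

/-- Where `sin² θ ≤ 1/2` the factor `2 cos² θ` is at least `1`; elsewhere the integrand is
exponentially small. The recurrence evaluates the integral with the factor `2 cos² θ` inserted. -/
theorem sinIntegral_succ_le (k : ℕ) {τ : ℝ} (hτ : 0 < τ) :
    sinIntegral (k + 1) τ ≤ (2 * k + 1) * sinIntegral k τ + π * (τ ^ (k + 1) * exp (-(τ / 2))) := by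
  have hpt : ∀ θ : ℝ, (τ * sin θ ^ 2) ^ (k + 1) * exp (-(τ * sin θ ^ 2)) ≤
      2 * ((τ * sin θ ^ 2) ^ (k + 1) * exp (-(τ * sin θ ^ 2)))
      - 2 / τ * ((τ * sin θ ^ 2) ^ (k + 2) * exp (-(τ * sin θ ^ 2)))
      + τ ^ (k + 1) * exp (-(τ / 2)) := by
    intro θ
    have hs : sin θ ^ 2 ≤ 1 := sin_sq_le_one θ
    have he : 2 / τ * ((τ * sin θ ^ 2) ^ (k + 2) * exp (-(τ * sin θ ^ 2)))
        = 2 * sin θ ^ 2 * ((τ * sin θ ^ 2) ^ (k + 1) * exp (-(τ * sin θ ^ 2))) := by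
      rw [pow_succ (τ * sin θ ^ 2) (k + 1)]
      field_simp
    rw [he]
    have hw : 0 ≤ (τ * sin θ ^ 2) ^ (k + 1) * exp (-(τ * sin θ ^ 2)) := by positivity
    rcases le_total (sin θ ^ 2) (1 / 2) with h | h
    · have : 0 ≤ τ ^ (k + 1) * exp (-(τ / 2)) := by positivity
      nlinarith
    · have : (τ * sin θ ^ 2) ^ (k + 1) * exp (-(τ * sin θ ^ 2))
          ≤ τ ^ (k + 1) * exp (-(τ / 2)) := by
        gcongr
        · exact mul_le_of_le_one_right hτ.le hs
        · nlinarith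
      nlinarith
  have h := intervalIntegral.integral_mono (a := 0) (b := π) (μ := MeasureTheory.volume) pi_pos.le
    (Continuous.intervalIntegrable (by fun_prop) _ _)
    (Continuous.intervalIntegrable (by fun_prop) _ _) hpt
  rw [intervalIntegral.integral_add, intervalIntegral.integral_sub] at h
  · simp only [intervalIntegral.integral_const_mul, intervalIntegral.integral_const, sub_zero,
      smul_eq_mul] at h
    have hJ : ∀ j, ∫ θ in (0 : ℝ)..π, (τ * sin θ ^ 2) ^ j * exp (-(τ * sin θ ^ 2))
        = sinIntegral j τ := fun _ => rfl
    simp only [hJ] at h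
    have hr := sinIntegral_recurrence k τ
    have hn := sinIntegral_nonneg (k + 1) hτ.le
    have e : 2 / τ * sinIntegral (k + 2) τ = (2 * k + 2) / τ * sinIntegral (k + 1) τ
        + 2 * sinIntegral (k + 1) τ - (2 * k + 1) * sinIntegral k τ := by
      field_simp
      linarith
    have h3 : 0 ≤ (2 * k + 2) / τ * sinIntegral (k + 1) τ := by positivity
    linarith
  all_goals exact Continuous.intervalIntegrable (by fun_prop) _ _

/-- The rate `1/4` only has to beat the tail `exp (-(τ / 2))`; restricting to `θ ≤ 1/2` achieves it.
-/
theorem le_sinIntegral_zero {τ : ℝ} (hτ : 0 ≤ τ) :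
    1 / 2 * exp (-(τ / 4)) ≤ sinIntegral 0 τ := by
  have h1 : ∫ θ in (0 : ℝ)..(1 / 2), exp (-(τ * sin θ ^ 2)) ≤ sinIntegral 0 τ := by
    simp only [sinIntegral, pow_zero, one_mul]
    exact intervalIntegral.integral_mono_interval le_rfl (by norm_num)
      (by linarith [pi_gt_three]) (Eventually.of_forall fun θ => (exp_pos _).le)
      (Continuous.intervalIntegrable (by fun_prop) _ _)
  have h2 : ∫ _ in (0 : ℝ)..(1 / 2), exp (-(τ / 4))
      ≤ ∫ θ in (0 : ℝ)..(1 / 2), exp (-(τ * sin θ ^ 2)) := by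
    refine intervalIntegral.integral_mono_on (by norm_num)
      (Continuous.intervalIntegrable (by fun_prop) _ _)
      (Continuous.intervalIntegrable (by fun_prop) _ _) fun θ hθ => ?_
    refine exp_le_exp.mpr (neg_le_neg ?_)
    have hs : |sin θ| ≤ 1 / 2 :=
      (abs_sin_le_abs (x := θ)).trans (by rw [abs_of_nonneg hθ.1]; exact hθ.2)
    have : sin θ ^ 2 ≤ 1 / 4 := by
      rw [← sq_abs]
      nlinarith [abs_nonneg (sin θ)]
    nlinarith
  rw [intervalIntegral.integral_const, smul_eq_mul, sub_zero] at h2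
  exact h2.trans h1

theorem sinIntegral_zero_pos {τ : ℝ} (hτ : 0 ≤ τ) : 0 < sinIntegral 0 τ :=
  lt_of_lt_of_le (by positivity) (le_sinIntegral_zero hτ)

theorem sinIntegral_ratio_isBigO_one (k : ℕ) :
    (fun τ => sinIntegral k τ / sinIntegral 0 τ) =O[atTop] (fun _ => (1 : ℝ)) := by
  induction k with
  | zero =>
    refine IsBigO.of_bound 1 ?_
    filter_upwards [eventually_ge_atTop 0] with τ hτ
    rw [div_self (sinIntegral_zero_pos hτ).ne']
    simp
  | succ k ih =>
    have he : (fun τ : ℝ => τ ^ (k + 1) * exp (-(1 / 4 * τ))) =O[atTop] (fun _ => (1 : ℝ)) := by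
      have h := ((isLittleO_pow_exp_pos_mul_atTop (b := 1 / 4) (k + 1) (by norm_num)).isBigO).mul
        (isBigO_refl (fun τ : ℝ => exp (-(1 / 4 * τ))) atTop)
      refine h.congr_right fun τ => ?_
      rw [← exp_add, add_neg_cancel, exp_zero]
    refine IsBigO.trans ?_ ((ih.const_mul_left (2 * k + 1)).add (he.const_mul_left (2 * π)))
    refine IsBigO.of_bound 1 ?_
    filter_upwards [eventually_gt_atTop 0] with τ hτ
    have hJ := sinIntegral_zero_pos hτ.le
    have hk := sinIntegral_nonneg k hτ.le
    have hk1 := sinIntegral_nonneg (k + 1) hτ.le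
    rw [one_mul, norm_of_nonneg (by positivity), norm_of_nonneg (by positivity),
      div_le_iff₀ hJ]
    have h1 := sinIntegral_succ_le k hτ
    have h2 := le_sinIntegral_zero hτ.le
    have h3 : exp (-(τ / 2)) = exp (-(1 / 4 * τ)) * exp (-(τ / 4)) := by
      rw [← exp_add]; ring_nf
    have h4 : π * (τ ^ (k + 1) * exp (-(τ / 2)))
        ≤ 2 * π * (τ ^ (k + 1) * exp (-(1 / 4 * τ))) * sinIntegral 0 τ := by
      calc π * (τ ^ (k + 1) * exp (-(τ / 2)))
          = 2 * π * (τ ^ (k + 1) * exp (-(1 / 4 * τ))) * (1 / 2 * exp (-(τ / 4))) := by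
            rw [h3]; ring
        _ ≤ _ := by gcongr
    have h5 : (2 * k + 1) * (sinIntegral k τ / sinIntegral 0 τ) * sinIntegral 0 τ
        = (2 * k + 1) * sinIntegral k τ := by field_simp
    rw [add_mul, h5]
    linarith

/-- The normalised moments `Γ(k + 1/2) / Γ(1/2)`. -/
noncomputable def halfMoment : ℕ → ℝ
  | 0 => 1
  | k + 1 => (k + 1 / 2) * halfMoment k

theorem halfMoment_pos (k : ℕ) : 0 < halfMoment k := by
  induction k with
  | zero => exact one_pos
  | succ k ih => exact mul_pos (by positivity) ih

/-- Divided by `2τ`, the recurrence reads `J (k+1) = (k + 1/2) J k` plus `1/τ` times integrals whose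
ratios to `J 0` are bounded. -/
theorem approxConst_sinIntegral_ratio (k : ℕ) :
    ApproxConst atTop (fun τ => sinIntegral k τ / sinIntegral 0 τ) (halfMoment k) := by
  have hl : Tendsto (fun t : ℝ => t⁻¹) atTop (nhds 0) := tendsto_inv_atTop_zero
  induction k with
  | zero =>
    refine (ApproxConst.const atTop 1).congr' ?_
    filter_upwards [eventually_ge_atTop 0] with τ hτ
    rw [div_self (sinIntegral_zero_pos hτ).ne']
  | succ k ih =>
    have hrem : ApproxConst atTop (fun τ => τ⁻¹ * (sinIntegral (k + 2) τ / sinIntegral 0 τ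
        - (k + 1) * (sinIntegral (k + 1) τ / sinIntegral 0 τ))) 0 := by
      have h := (isBigO_refl (fun τ : ℝ => τ⁻¹) atTop).mul
        ((sinIntegral_ratio_isBigO_one (k + 2)).sub
          ((sinIntegral_ratio_isBigO_one (k + 1)).const_mul_left (k + 1 : ℝ)))
      simpa [ApproxConst] using h
    refine ((((ApproxConst.const atTop (k + 1 / 2 : ℝ)).mul hl ih).add hrem).congr' ?_).of_eq
      (add_zero _)
    filter_upwards [eventually_gt_atTop 0] with τ hτ
    have hJ := (sinIntegral_zero_pos hτ.le).ne'
    have hr := sinIntegral_recurrence k τ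
    field_simp
    linarith

end SinIntegral

/-! ### Rescaled moments of the evolving functional -/

section Rescaled

open Polynomial

/-- Moments in the variable `d - t x²` of the rescaled even orthogonal polynomials. -/
noncomputable def rescaledMoment (L : ℝ[X] →ₗ[ℝ] ℝ) (t d : ℝ) (n k : ℕ) : ℝ :=
  L (orthoPoly L (2 * n) * (C ((-t) ^ n) * (C d - C t * X ^ 2) ^ k))

theorem orthoPoly_two_mul_succ (L : ℝ[X] →ₗ[ℝ] ℝ) (n : ℕ) :
    orthoPoly L (2 * (n + 1)) =
      (X ^ 2 - C (recCoeff L (2 * n) + recCoeff L (2 * n + 1))) * orthoPoly L (2 * n)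
      - C (recCoeff L (2 * n) * recCoeff L (2 * n - 1)) * orthoPoly L (2 * (n - 1)) := by
  rw [show 2 * (n + 1) = 2 * n + 1 + 1 by ring, orthoPoly_succ, Nat.add_sub_cancel,
    orthoPoly_succ L (2 * n)]
  cases n with
  | zero => simp [recCoeff]; ring
  | succ m =>
    have h := orthoPoly_succ L (2 * m + 1)
    rw [show 2 * (m + 1) = 2 * m + 1 + 1 by ring, Nat.add_sub_cancel, Nat.add_sub_cancel, h,
      Nat.add_sub_cancel]
    simp only [C_add, C_mul]
    ring

/-- The factor `(-t)^n` makes the polynomial monic in `y = d - t x²`, so this is a three-term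
recurrence in `y`. -/
theorem rescaledMoment_succ (L : ℝ[X] →ₗ[ℝ] ℝ) (t d : ℝ) (n k : ℕ) :
    rescaledMoment L t d (n + 1) k = rescaledMoment L t d n (k + 1)
      - (d - t * (recCoeff L (2 * n) + recCoeff L (2 * n + 1))) * rescaledMoment L t d n k
      - t ^ 2 * (recCoeff L (2 * n) * recCoeff L (2 * n - 1))
        * rescaledMoment L t d (n - 1) k := by
  simp only [rescaledMoment]
  rw [← smul_eq_mul (d - _), ← map_smul, ← smul_eq_mul (t ^ 2 * _), ← map_smul, ← map_sub,
    ← map_sub]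
  congr 1
  rw [orthoPoly_two_mul_succ, smul_eq_C_mul, smul_eq_C_mul]
  cases n with
  | zero =>
    simp only [C_add, C_mul, C_sub, C_pow, C_neg, recCoeff, C_0]
    ring
  | succ m =>
    simp only [C_add, C_mul, C_sub, C_pow, C_neg, Nat.add_sub_cancel]
    ring

theorem rescaledMoment_eq_zero {L : ℝ[X] →ₗ[ℝ] ℝ} (hodd : ∀ k, Odd k → L (X ^ k) = 0)
    (hpos : ∀ q : ℝ[X], q ≠ 0 → 0 < L (q * q)) (t d : ℝ) {n k : ℕ} (hk : k < n) :
    rescaledMoment L t d n k = 0 := by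
  refine map_orthoPoly_mul_eq_zero hodd hpos ?_
  have h2 : (C d - C t * X ^ 2 : ℝ[X]).natDegree ≤ 2 := by compute_degree
  have h3 := (natDegree_C_mul_le ((-t) ^ n) ((C d - C t * X ^ 2 : ℝ[X]) ^ k)).trans
    (natDegree_pow_le_of_le k h2)
  refine lt_of_le_of_lt degree_le_natDegree ?_
  exact_mod_cast (by omega :
    (C ((-t) ^ n) * (C d - C t * X ^ 2 : ℝ[X]) ^ k).natDegree < 2 * n)

open Real

theorem rescaledMoment_zero_left (t d : ℝ) (k : ℕ) :
    rescaledMoment (semicircleFunctional t) t d 0 k =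
      ∫ θ in (0 : ℝ)..π, (d - t * (2 * cos θ) ^ 2) ^ k
        * (exp (t * (2 * cos θ) ^ 2) * sin θ ^ 2) := by
  simp [rescaledMoment, orthoPoly, semicircleFunctional_apply]

/-- The weight `sin² θ` equals `y / (4t)` and raises the index by one; hence `α = 1/2` here. -/
theorem rescaledMoment_top {t : ℝ} (ht : t ≠ 0) (k : ℕ) :
    rescaledMoment (semicircleFunctional t) t (4 * t) 0 k =
      exp (4 * t) / (4 * t) * sinIntegral (k + 1) (4 * t) := by
  rw [rescaledMoment_zero_left, sinIntegral, ← intervalIntegral.integral_const_mul]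
  refine intervalIntegral.integral_congr fun θ _ => ?_
  have hc : (2 * cos θ) ^ 2 = 4 - 4 * sin θ ^ 2 := by
    rw [mul_pow, cos_sq']; ring
  simp only [hc]
  rw [show t * (4 - 4 * sin θ ^ 2) = 4 * t + -(4 * t * sin θ ^ 2) by ring, exp_add]
  rw [show 4 * t - (4 * t + -(4 * t * sin θ ^ 2)) = 4 * t * sin θ ^ 2 by ring]
  field_simp
  ring

theorem integral_cos_sq_eq_integral_sin_sq (g : ℝ → ℝ) :
    ∫ θ in (0 : ℝ)..π, g (cos θ ^ 2) = ∫ θ in (0 : ℝ)..π, g (sin θ ^ 2) := by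
  have hper : Function.Periodic (fun θ => g (sin θ ^ 2)) π := fun θ => by
    simp only [sin_add_pi, neg_sq]
  have h := intervalIntegral.integral_comp_add_right (a := 0) (b := π)
    (fun θ => g (sin θ ^ 2)) (π / 2)
  simp only [sin_add_pi_div_two] at h
  rw [h, zero_add, add_comm π, hper.intervalIntegral_add_eq (π / 2) 0, zero_add]

/-- Near `x = 0` the weight `sin² θ = 1 - cos² θ` is `1` to leading order, so the index is not
raised and `α = -1/2`. -/
theorem rescaledMoment_bot {t : ℝ} (ht : t ≠ 0) (k : ℕ) :
    rescaledMoment (semicircleFunctional t) t 0 0 k =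
      sinIntegral k (-4 * t) - (-4 * t)⁻¹ * sinIntegral (k + 1) (-4 * t) := by
  have h1 : rescaledMoment (semicircleFunctional t) t 0 0 k =
      ∫ θ in (0 : ℝ)..π, (fun x => (-4 * t * x) ^ k * exp (-(-4 * t * x)) * (1 - x))
        (cos θ ^ 2) := by
    rw [rescaledMoment_zero_left]
    refine intervalIntegral.integral_congr fun θ _ => ?_
    simp only [sin_sq θ, mul_pow 2 (cos θ)]
    ring_nf
  rw [h1, integral_cos_sq_eq_integral_sin_sq
    (fun x => (-4 * t * x) ^ k * exp (-(-4 * t * x)) * (1 - x)), sinIntegral, sinIntegral,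
    ← intervalIntegral.integral_const_mul, ← intervalIntegral.integral_sub]
  · refine intervalIntegral.integral_congr fun θ _ => ?_
    simp only [pow_succ (-4 * t * sin θ ^ 2) k]
    field_simp
  all_goals exact Continuous.intervalIntegrable (by fun_prop) _ _

/-- Asymptotics of the recurrence coefficients in the variable `d t - t x²`, given those of the
normalised moments. -/
theorem approxConst_recCoeff_of_moments {l : Filter ℝ}
    (hl : Tendsto (fun t : ℝ => t⁻¹) l (nhds 0)) {M : ℕ → ℝ} {α : ℝ} {d N : ℝ → ℝ}
    (hM0 : ∀ k, M k ≠ 0) (hM : ∀ k : ℕ, M (k + 1) = (k + 1 + α) * M k)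
    (h0 : ∀ k, ApproxConst l
      (fun t => rescaledMoment (semicircleFunctional t) t (d t) 0 k / N t) (M k)) (n : ℕ) :
    ApproxConst l (fun t => d t - t * (recCoeff (semicircleFunctional t) (2 * n)
      + recCoeff (semicircleFunctional t) (2 * n + 1))) (2 * n + 1 + α) ∧
    ApproxConst l (fun t => t ^ 2 * (recCoeff (semicircleFunctional t) (2 * n)
      * recCoeff (semicircleFunctional t) (2 * n - 1))) (n * (n + α)) := by
  refine approxConst_laguerre_recurrence hl
    (σ := fun n k t => rescaledMoment (semicircleFunctional t) t (d t) n k / N t)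
    (A := fun n t => d t - t * (recCoeff (semicircleFunctional t) (2 * n)
      + recCoeff (semicircleFunctional t) (2 * n + 1)))
    (B := fun n t => t ^ 2 * (recCoeff (semicircleFunctional t) (2 * n)
      * recCoeff (semicircleFunctional t) (2 * n - 1))) hM0 hM ?_ h0 ?_ ?_ n
  · intro t
    simp [recCoeff]
  · intro n k t
    simp only [rescaledMoment_succ]
    ring
  · intro n k hk t
    simp only [rescaledMoment_eq_zero (semicircleFunctional_odd t) (semicircleFunctional_pos t)
      t (d t) hk, zero_div]

theorem approxConst_comp_mul {l : Filter ℝ} {f : ℝ → ℝ} {a c : ℝ}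
    (hl : Tendsto (fun t => a * t) l atTop) (hf : ApproxConst atTop f c) :
    ApproxConst l (fun t => f (a * t)) c := by
  refine (IsBigO.comp_tendsto hf hl).trans ?_
  exact ((isBigO_refl (fun t : ℝ => t⁻¹) l).const_mul_left a⁻¹).congr_left fun t => by
    simp [mul_comm]

theorem approxConst_recCoeff_top (n : ℕ) :
    ApproxConst atTop (fun t => 4 * t - t * (recCoeff (semicircleFunctional t) (2 * n)
      + recCoeff (semicircleFunctional t) (2 * n + 1))) (2 * n + 1 + 1 / 2) ∧
    ApproxConst atTop (fun t => t ^ 2 * (recCoeff (semicircleFunctional t) (2 * n)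
      * recCoeff (semicircleFunctional t) (2 * n - 1))) (n * (n + 1 / 2)) := by
  refine approxConst_recCoeff_of_moments tendsto_inv_atTop_zero
    (M := fun k => halfMoment (k + 1)) (d := fun t => 4 * t)
    (N := fun t => exp (4 * t) / (4 * t) * sinIntegral 0 (4 * t))
    (fun k => (halfMoment_pos _).ne') (fun k => ?_) (fun k => ?_) n
  · rw [halfMoment]
    push_cast
    ring
  · refine (approxConst_comp_mul (tendsto_id.const_mul_atTop (by norm_num : (0 : ℝ) < 4))
      (approxConst_sinIntegral_ratio (k + 1))).congr' ?_
    filter_upwards [eventually_gt_atTop 0] with t ht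
    rw [rescaledMoment_top ht.ne', mul_div_mul_left _ _ (by positivity)]

theorem approxConst_recCoeff_bot (n : ℕ) :
    ApproxConst atBot (fun t => 0 - t * (recCoeff (semicircleFunctional t) (2 * n)
      + recCoeff (semicircleFunctional t) (2 * n + 1))) (2 * n + 1 + (-1 / 2)) ∧
    ApproxConst atBot (fun t => t ^ 2 * (recCoeff (semicircleFunctional t) (2 * n)
      * recCoeff (semicircleFunctional t) (2 * n - 1))) (n * (n + (-1 / 2))) := by
  have hl : Tendsto (fun t : ℝ => t⁻¹) atBot (nhds 0) := tendsto_inv_atBot_zero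
  have h4 : Tendsto (fun t : ℝ => -4 * t) atBot atTop :=
    tendsto_id.const_mul_atBot_of_neg (by norm_num)
  refine approxConst_recCoeff_of_moments hl
    (M := halfMoment) (d := fun _ => 0) (N := fun t => sinIntegral 0 (-4 * t))
    (fun k => (halfMoment_pos _).ne') (fun k => ?_) (fun k => ?_) n
  · rw [halfMoment]
    ring
  · have hinv : ApproxConst atBot (fun t : ℝ => (-4)⁻¹ * t⁻¹) 0 := by
      simpa using (ApproxConst.const atBot (-4 : ℝ)⁻¹).mul hl (ApproxConst.inv_id atBot)
    refine (((approxConst_comp_mul h4 (approxConst_sinIntegral_ratio k)).sub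
      (hinv.mul hl (approxConst_comp_mul h4 (approxConst_sinIntegral_ratio (k + 1))))).congr'
        ?_).of_eq (by ring)
    filter_upwards [eventually_lt_atBot 0] with t ht
    rw [rescaledMoment_bot ht.ne, sub_div, mul_inv, mul_div_assoc]

end Rescaled

/-! ### Asymptotics of the solution -/

section Asymptotics

/-- Since `u (2n+1)` tends to `4`, the product asymptotics give `u (2n+2)`, whose size `O(t⁻²)`
makes it negligible in the sum that determines `u (2n+3)`. -/
theorem approxConst_step_top {u : ℕ → ℝ → ℝ} (h0 : ∀ t, u 0 t = 0)
    (hA : ∀ n : ℕ, ApproxConst atTop (fun t => 4 * t - t * (u (2 * n) t + u (2 * n + 1) t))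
      (2 * n + 1 + 1 / 2))
    (hB : ∀ n : ℕ, ApproxConst atTop (fun t => t ^ 2 * (u (2 * n) t * u (2 * n - 1) t))
      (n * (n + 1 / 2))) (n : ℕ) :
    ApproxConst atTop (fun t => t ^ 2 * u (2 * n) t) (n * (2 * n + 1) / 8) ∧
    ApproxConst atTop (fun t => t * (4 - u (2 * n + 1) t)) ((4 * n + 3) / 2) := by
  have hl : Tendsto (fun t : ℝ => t⁻¹) atTop (nhds 0) := tendsto_inv_atTop_zero
  have hodd : ∀ n : ℕ, ApproxConst atTop (fun t => t ^ 2 * u (2 * n) t) (n * (2 * n + 1) / 8) →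
      ApproxConst atTop (fun t => t * (4 - u (2 * n + 1) t)) ((4 * n + 3) / 2) := by
    intro n hn
    refine (((hA n).add ((ApproxConst.inv_id atTop).mul hl hn)).congr' ?_).of_eq (by ring)
    filter_upwards [eventually_gt_atTop 0] with t ht
    field_simp
    ring
  suffices h : ApproxConst atTop (fun t => t ^ 2 * u (2 * n) t) (n * (2 * n + 1) / 8) from
    ⟨h, hodd n h⟩
  induction n with
  | zero => simpa [h0] using ApproxConst.const atTop 0
  | succ n ih =>
    have h4 : ApproxConst atTop (fun t => u (2 * n + 1) t) 4 := by
      refine (((ApproxConst.const atTop 4).sub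
        ((ApproxConst.inv_id atTop).mul hl (hodd n ih))).congr' ?_).of_eq (by ring)
      filter_upwards [eventually_gt_atTop 0] with t ht
      field_simp
      ring
    refine (((hB (n + 1)).div hl h4 four_ne_zero).congr' ?_).of_eq (by push_cast; ring)
    filter_upwards [h4.eventually_ne hl four_ne_zero] with t ht
    rw [show 2 * (n + 1) - 1 = 2 * n + 1 by omega]
    field_simp

theorem approxConst_step_bot {u : ℕ → ℝ → ℝ} (h0 : ∀ t, u 0 t = 0)
    (hA : ∀ n : ℕ, ApproxConst atBot (fun t => 0 - t * (u (2 * n) t + u (2 * n + 1) t))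
      (2 * n + 1 + (-1 / 2)))
    (hB : ∀ n : ℕ, ApproxConst atBot (fun t => t ^ 2 * (u (2 * n) t * u (2 * n - 1) t))
      (n * (n + (-1 / 2)))) (n : ℕ) : ApproxConst atBot (fun t => t * u n t) (-n / 2) := by
  have hl : Tendsto (fun t : ℝ => t⁻¹) atBot (nhds 0) := tendsto_inv_atBot_zero
  have hodd : ∀ n : ℕ, ApproxConst atBot (fun t => t * u (2 * n) t) (-(2 * n : ℕ) / 2) →
      ApproxConst atBot (fun t => t * u (2 * n + 1) t) (-(2 * n + 1 : ℕ) / 2) := by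
    intro n hn
    refine ((((ApproxConst.const atBot 0).sub (hA n)).sub hn).congr'
      (Eventually.of_forall fun t => ?_)).of_eq (by push_cast; ring)
    ring
  have heven : ∀ n : ℕ, ApproxConst atBot (fun t => t * u (2 * n) t) (-(2 * n : ℕ) / 2) := by
    intro n
    induction n with
    | zero => simpa [h0] using ApproxConst.const atBot 0
    | succ n ih =>
      have hne : (-(2 * n + 1 : ℕ) / 2 : ℝ) ≠ 0 := by
        refine ne_of_lt ?_
        have : (0 : ℝ) < (2 * n + 1 : ℕ) := by positivity
        linarith
      refine (((hB (n + 1)).div hl (hodd n ih) hne).congr' ?_).of_eq ?_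
      · filter_upwards [(hodd n ih).eventually_ne hl hne] with t ht
        rw [show 2 * (n + 1) - 1 = 2 * n + 1 by omega, div_eq_iff ht]
        ring
      · rw [div_eq_iff hne]
        push_cast
        ring
  obtain ⟨m, rfl | rfl⟩ := Nat.even_or_odd' n
  · exact heven m
  · exact hodd m (heven m)

end Asymptotics

theorem mainTheorem4 :
    (∃! u : ℕ → ℝ → ℝ, IsVolterraStepSolution u) ∧
    ∀ u : ℕ → ℝ → ℝ, IsVolterraStepSolution u →
      (∀ j : ℕ, 1 ≤ j →
        (fun t : ℝ => u (2 * j - 1) t - (4 - (4 * (j : ℝ) - 1) / (2 * t)))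
          =O[atTop] (fun t : ℝ => t ^ (-2 : ℤ))) ∧
      (∀ j : ℕ,
        (fun t : ℝ => u (2 * j) t - (j : ℝ) * (2 * (j : ℝ) + 1) / (8 * t ^ 2))
          =O[atTop] (fun t : ℝ => t ^ (-3 : ℤ))) ∧
      (∀ n : ℕ,
        (fun t : ℝ => u n t - (-(n : ℝ) / (2 * t)))
          =O[atBot] (fun t : ℝ => t ^ (-2 : ℤ))) := by
  refine ⟨⟨_, isVolterraStepSolution_recCoeff, fun v hv =>
    hv.unique isVolterraStepSolution_recCoeff⟩, fun u hu => ?_⟩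
  obtain rfl := hu.unique isVolterraStepSolution_recCoeff
  have htop := approxConst_step_top (u := fun n t => recCoeff (semicircleFunctional t) n)
    hu.boundary
    (fun n => (approxConst_recCoeff_top n).1) (fun n => (approxConst_recCoeff_top n).2)
  have hbot := approxConst_step_bot (u := fun n t => recCoeff (semicircleFunctional t) n)
    hu.boundary
    (fun n => (approxConst_recCoeff_bot n).1) (fun n => (approxConst_recCoeff_bot n).2)
  have e2 : ∀ t : ℝ, t ^ (-2 : ℤ) = t⁻¹ * t⁻¹ := fun t => by
    rw [zpow_neg, ← mul_inv, ← sq]; rfl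
  have e3 : ∀ t : ℝ, t ^ (-3 : ℤ) = (t⁻¹) ^ 2 * t⁻¹ := fun t => by
    rw [zpow_neg, inv_pow, ← mul_inv, ← pow_succ]; rfl
  refine ⟨fun j hj => ?_, fun j => ?_, fun n => ?_⟩
  · obtain ⟨m, rfl⟩ := Nat.exists_eq_add_of_le' hj
    simp only [e2, show 2 * (m + 1) - 1 = 2 * m + 1 by omega]
    refine (((isBigO_refl (fun t : ℝ => t⁻¹) atTop).neg_left).mul (htop m).2).congr' ?_
      EventuallyEq.rfl
    filter_upwards [eventually_gt_atTop 0] with t ht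
    push_cast
    field_simp
    ring
  · simp only [e3]
    refine ((isBigO_refl (fun t : ℝ => (t⁻¹) ^ 2) atTop).mul (htop j).1).congr' ?_
      EventuallyEq.rfl
    filter_upwards [eventually_gt_atTop 0] with t ht
    field_simp
  · simp only [e2]
    refine ((isBigO_refl (fun t : ℝ => t⁻¹) atBot).mul (hbot n)).congr' ?_ EventuallyEq.rfl
    filter_upwards [eventually_lt_atBot 0] with t ht
    have := ht.ne
    field_simp
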